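/- Let $n>1$ be an integer and let $\zeta\in\mathbb{C}$ be a primitive $n$-th root of unity. For a positive integer $m$, let $D(m)$ be the set of derangements of $\{1,\dots,m\}$, i.e. permutations $\tau$ with $\tau(j)\neq j$ for all $j=1,\dots,m$. If $n$ is even, then $$\sum_{\tau\in D(n)}\prod_{j=1}^{n}\frac{1}{1-\zeta^{j-\tau(j)}}=\frac{((n-1)!!)^2}{2^n}=\frac{n!}{4^n}\binom{n}{n/2}.$$ If $n$ is odd, then $$\sum_{\tau\in D(n-1)}\prod_{j=1}^{n-1}\frac{1}{1-\zeta^{j-\tau(j)}}=\frac{1}{n}\left(\left(\frac{n-1}{2}\right)!\right)^2.$$ -/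

import Mathlib

/-- `derangementSum ζ m` is the sum over all derangements `τ` of `m` indices of the product
over all indices `j` of `1 / (1 - ζ ^ (j - τ j))`, with an integer exponent. The indices are
`0, …, m - 1`; only their differences matter, so this is the sum over `1, …, m`. -/
noncomputable def derangementSum (ζ : ℂ) (m : ℕ) : ℂ :=
  ∑ τ : derangements (Fin m),
    ∏ j : Fin m, 1 / (1 - ζ ^ (((j : ℕ) : ℤ) - (((τ : Equiv.Perm (Fin m)) j : ℕ) : ℤ)))

open Equiv Equiv.Perm Finset

/-! Since `0⁻¹ = 0`, fixed points contribute nothing, and the derangement sum is ∏ ζ^j times the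
permanent of the zero-diagonal matrix 1/(x_a - x_b), x_j = ζ^j. For any distinct nodes, inserting
one node into the cycles of a permutation of the others telescopes by partial fractions, and only
its 2-cycles survive. Permanent and determinant thus obey the same recursion up to one sign per
pair, so on 2m nodes they differ by (-1)^m (`signedDiffSum_zero_eq`). Over all n roots the
determinant is that of a circulant with eigenvalues (n-1)/2 - k, 0 ≤ k < n. For n even, multiply
them; for n odd, one vanishes and each principal minor of size n-1 is the product of the others
divided by n. -/

/-! ### Permanent versus determinant for distinct nodes -/

/-- The signed (`k` odd) or unsigned (`k` even) sum over all permutations `σ` of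
`∏ a, 1 / (x (σ a) - x a)`; permutations with a fixed point contribute `0`. -/
def signedDiffSum {α K : Type*} [Fintype α] [DecidableEq α] [Field K] (k : ℕ) (x : α → K) : K :=
  ∑ σ : Perm α, ((sign σ : ℤ) : K) ^ k * ∏ a, (x (σ a) - x a)⁻¹

theorem signedDiffSum_comp_equiv {α β K : Type*} [Fintype α] [DecidableEq α] [Fintype β]
    [DecidableEq β] [Field K] (k : ℕ) (x : α → K) (e : β ≃ α) :
    signedDiffSum k (x ∘ e) = signedDiffSum k x := by
  unfold signedDiffSum
  refine Fintype.sum_equiv e.permCongr _ _ fun σ => ?_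
  rw [sign_permCongr]
  congr 1
  exact Fintype.prod_equiv e _ _ fun a => by simp [permCongr_apply]

theorem sum_perm_fixing_eq {α K : Type*} [Fintype α] [DecidableEq α] [Field K] (k : ℕ) (b : α)
    (f : α → α → K) :
    (∑ σ : Perm α, if σ b = b then
      ((sign σ : ℤ) : K) ^ k * ∏ a ∈ univ.erase b, f (σ a) a else 0) =
    ∑ σ : Perm {a // a ≠ b}, ((sign σ : ℤ) : K) ^ k * ∏ a, f (σ a) a := by
  rw [← sum_filter]
  symm
  refine sum_bij (fun σ _ => ofSubtype σ) ?_ ?_ ?_ ?_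
  · intro σ _
    simp [ofSubtype_apply_of_not_mem]
  · intro σ _ τ _ h
    exact ofSubtype_injective h
  · intro σ hσ
    have hb : σ b = b := by simpa using hσ
    have h1 : ∀ a, σ a ≠ b ↔ a ≠ b := fun a => by
      conv_lhs => rw [← hb]
      simp
    refine ⟨σ.subtypePerm h1, mem_univ _, ofSubtype_subtypePerm _ ?_⟩
    intro a ha hab
    exact ha (by rw [hab, hb])
  · intro σ _
    rw [sign_ofSubtype]
    congr 1
    have h2 : univ.erase b = univ.filter (fun a => a ≠ b) := by ext; simp
    rw [h2, ← prod_subtype_eq_prod_filter]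
    simp [Finset.subtype_univ]

/-- Here `none` is inserted just before `b` in its cycle. Partial fractions in `x none` give the
last term; if `σ b = b`, that term vanishes and the new 2-cycle gives the first. -/
theorem prod_inv_sub_decomposeOption_symm {α K : Type*} [Fintype α] [DecidableEq α] [Field K]
    (x : Option α → K) (hx : Function.Injective x) (b : α) (σ : Perm α) :
    ∏ a, (x (decomposeOption.symm (some b, σ) a) - x a)⁻¹ =
      -((x none - x (some b))⁻¹) ^ 2 * (if σ b = b then
        ∏ a ∈ univ.erase b, (x (some (σ a)) - x (some a))⁻¹ else 0) +
      (∏ a, (x (some (σ a)) - x (some a))⁻¹) *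
        ((x none - x (some (σ.symm b)))⁻¹ - (x none - x (some b))⁻¹) := by
  have h0 : ∀ a, x none - x (some a) ≠ 0 := fun a => sub_ne_zero.2 (hx.ne (by simp))
  have h0' : ∀ a, x (some a) - x none ≠ 0 := fun a => sub_ne_zero.2 (hx.ne (by simp))
  rw [Fintype.prod_option, ← mul_prod_erase univ _ (mem_univ (σ.symm b)),
    ← mul_prod_erase univ (fun a => (x (some (σ a)) - x (some a))⁻¹) (mem_univ (σ.symm b))]
  have h1 : ∏ a ∈ univ.erase (σ.symm b),
      (x (decomposeOption.symm (some b, σ) (some a)) - x (some a))⁻¹ =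
      ∏ a ∈ univ.erase (σ.symm b), (x (some (σ a)) - x (some a))⁻¹ := by
    refine prod_congr rfl fun a ha => ?_
    have : σ a ≠ b := fun h => (ne_of_mem_erase ha) (by simp [← h])
    simp [swap_apply_of_ne_of_ne, this]
  rw [h1]
  by_cases hb : σ b = b
  · have hc : σ.symm b = b := by rw [symm_apply_eq, hb]
    have h2 := h0 b
    have h3 := h0' b
    simp only [hc, hb, if_true]
    simp [hb]
    field_simp
    ring
  · have hc : σ.symm b ≠ b := fun h => hb (by rw [symm_apply_eq] at h; exact h.symm)
    have h2 := h0 (σ.symm b)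
    have h3 := h0 b
    have h3' := h0' b
    have h4 : x (some b) - x (some (σ.symm b)) ≠ 0 :=
      sub_ne_zero.2 (hx.ne (by simpa using hc.symm))
    simp [hb]
    field_simp
    ring

theorem signedDiffSum_option {α K : Type*} [Fintype α] [DecidableEq α] [Field K] (k : ℕ)
    (x : Option α → K) (hx : Function.Injective x) :
    signedDiffSum k x = ∑ b, (-1) ^ k * -((x none - x (some b))⁻¹) ^ 2 *
      signedDiffSum k (fun a : {a // a ≠ b} => x (some a)) := by
  have hL : signedDiffSum k x = ∑ σ : Perm α, ∑ b : α, (-1) ^ k * ((sign σ : ℤ) : K) ^ k *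
      ∏ a, (x (decomposeOption.symm (some b, σ) a) - x a)⁻¹ := by
    unfold signedDiffSum
    rw [← Equiv.sum_comp decomposeOption.symm, Fintype.sum_prod_type_right]
    refine sum_congr rfl fun σ _ => ?_
    rw [Fintype.sum_option, Fintype.prod_option]
    rw [show (decomposeOption.symm (none, σ)) none = none by simp, sub_self, inv_zero, zero_mul,
      mul_zero, zero_add]
    refine sum_congr rfl fun b _ => ?_
    congr 1
    simp [← mul_pow]
  -- The insertion terms cancel over `b`, since `σ.symm` only permutes the nodes.
  have hz : ∀ σ : Perm α, ∑ b,
      ((x none - x (some (σ.symm b)))⁻¹ - (x none - x (some b))⁻¹) = 0 := fun σ => by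
    rw [sum_sub_distrib, Equiv.sum_comp σ.symm (fun b => (x none - x (some b))⁻¹), sub_self]
  rw [hL]
  simp_rw [prod_inv_sub_decomposeOption_symm x hx, mul_add, sum_add_distrib, ← mul_assoc,
    ← mul_sum, hz, mul_zero, sum_const_zero, add_zero]
  rw [sum_comm]
  refine sum_congr rfl fun b _ => ?_
  unfold signedDiffSum
  rw [← sum_perm_fixing_eq k b (fun c a => (x (some c) - x (some a))⁻¹), mul_sum]
  refine sum_congr rfl fun σ _ => ?_
  split_ifs <;> ring

theorem signedDiffSum_zero_eq {K : Type*} [Field K] (m : ℕ) : ∀ {α : Type} [Fintype α]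
    [DecidableEq α] (x : α → K), Function.Injective x → Fintype.card α = 2 * m →
    signedDiffSum 0 x = (-1) ^ m * signedDiffSum 1 x := by
  induction m with
  | zero =>
    intro α _ _ x _ h
    have : IsEmpty α := Fintype.card_eq_zero_iff.1 (by simpa using h)
    simp [signedDiffSum]
  | succ m ih =>
    intro α _ _ x hx h
    obtain ⟨i⟩ : Nonempty α := Fintype.card_pos_iff.1 (by omega)
    have hi : Fintype.card {a // a ≠ i} = 2 * m + 1 := by
      have := Set.card_ne_eq i
      rw [h] at this
      exact this.trans (by omega)
    have hx' := hx.comp (optionSubtypeNe i).injective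
    rw [← signedDiffSum_comp_equiv 0 x (optionSubtypeNe i),
      ← signedDiffSum_comp_equiv 1 x (optionSubtypeNe i), signedDiffSum_option _ _ hx',
      signedDiffSum_option _ _ hx', mul_sum]
    refine sum_congr rfl fun b _ => ?_
    rw [ih (fun a : {a // a ≠ b} => (x ∘ optionSubtypeNe i) (some a))
      (hx'.comp ((Option.some_injective _).comp Subtype.val_injective))
      ((Set.card_ne_eq b).trans (by rw [hi]; omega))]
    ring


/-! ### Derangement sums at roots of unity as determinants -/

theorem one_div_one_sub_zpow_sub {ζ : ℂ} (hζ : ζ ≠ 0) (a b : ℕ) :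
    1 / (1 - ζ ^ ((a : ℤ) - (b : ℤ))) = ζ ^ b * (ζ ^ b - ζ ^ a)⁻¹ := by
  have hb : ζ ^ b ≠ 0 := pow_ne_zero _ hζ
  rw [zpow_sub₀ hζ, zpow_natCast, zpow_natCast, one_sub_div hb, one_div_div, div_eq_mul_inv]

theorem derangementSum_eq_prod_mul_signedDiffSum {ζ : ℂ} (hζ : ζ ≠ 0) (m : ℕ) :
    derangementSum ζ m =
      (∏ j : Fin m, ζ ^ (j : ℕ)) * signedDiffSum 0 (fun j : Fin m => ζ ^ (j : ℕ)) := by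
  classical
  have h1 : derangementSum ζ m = ∑ τ : Perm (Fin m),
      ∏ j : Fin m, 1 / (1 - ζ ^ (((j : ℕ) : ℤ) - ((τ j : ℕ) : ℤ))) := by
    unfold derangementSum
    rw [← sum_subtype (univ.filter (· ∈ derangements (Fin m))) (by simp)
      (fun τ : Perm (Fin m) =>
        ∏ j : Fin m, 1 / (1 - ζ ^ (((j : ℕ) : ℤ) - ((τ j : ℕ) : ℤ))))]
    refine sum_subset (subset_univ _) fun τ _ hτ => ?_
    have h2 : ∃ j, τ j = j := by
      by_contra! h
      exact hτ (mem_filter.2 ⟨mem_univ _, h⟩)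
    obtain ⟨j, hj⟩ := h2
    exact prod_eq_zero (mem_univ j) (by simp [hj])
  rw [h1, signedDiffSum, mul_sum]
  refine sum_congr rfl fun τ _ => ?_
  simp_rw [one_div_one_sub_zpow_sub hζ, prod_mul_distrib]
  rw [Equiv.prod_comp τ (fun j : Fin m => ζ ^ (j : ℕ))]
  simp

/-- The matrix with entries `1 / (1 - ζ ^ (j - k))`, zero on the diagonal. -/
noncomputable def diffMatrix (ζ : ℂ) (m : ℕ) : Matrix (Fin m) (Fin m) ℂ :=
  Matrix.of fun j l => ζ ^ (l : ℕ) * (ζ ^ (l : ℕ) - ζ ^ (j : ℕ))⁻¹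

theorem det_diffMatrix (ζ : ℂ) (m : ℕ) : (diffMatrix ζ m).det =
    (∏ j : Fin m, ζ ^ (j : ℕ)) * signedDiffSum 1 (fun j : Fin m => ζ ^ (j : ℕ)) := by
  rw [← Matrix.det_transpose, Matrix.det_apply', signedDiffSum, mul_sum]
  refine sum_congr rfl fun τ _ => ?_
  simp only [diffMatrix, Matrix.transpose_apply, Matrix.of_apply, prod_mul_distrib]
  rw [Equiv.prod_comp τ (fun j : Fin m => ζ ^ (j : ℕ))]
  ring

theorem derangementSum_eq_det {n : ℕ} {ζ : ℂ} (hζ : IsPrimitiveRoot ζ n) (hn : n ≠ 0) (m : ℕ)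
    (hm : 2 * m ≤ n) :
    derangementSum ζ (2 * m) = (-1) ^ m * (diffMatrix ζ (2 * m)).det := by
  rw [derangementSum_eq_prod_mul_signedDiffSum (hζ.ne_zero hn), det_diffMatrix,
    signedDiffSum_zero_eq m _ _ (by simp)]
  · ring
  · intro i j h
    exact Fin.ext (hζ.pow_inj (by omega) (by omega) h)

/-! ### Spectrum and principal minors of the circulant -/

theorem sum_pow_pow_eq_zero {n : ℕ} {ζ : ℂ} (hζ : IsPrimitiveRoot ζ n) {k : ℕ} (hk : ¬ n ∣ k) :
    ∑ l : Fin n, (ζ ^ (l : ℕ)) ^ k = 0 := by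
  rw [Fin.sum_univ_eq_sum_range (fun l => (ζ ^ l) ^ k)]
  have h1 : ζ ^ k ≠ 1 := fun h => hk ((hζ.pow_eq_one_iff_dvd k).1 h)
  have h2 := geom_sum_mul (ζ ^ k) n
  rw [pow_right_comm, hζ.pow_eq_one, one_pow, sub_self] at h2
  simp_rw [pow_right_comm ζ _ k]
  exact (mul_eq_zero.1 h2).resolve_right (sub_ne_zero.2 h1)

theorem sum_ratio_pow_mul {n : ℕ} {ζ : ℂ} (hζ : IsPrimitiveRoot ζ n) (hn : 1 < n)
    (j : Fin n) {k : ℕ} (hk : k < n) :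
    ∑ l : Fin n, (ζ ^ (l : ℕ) / ζ ^ (j : ℕ)) ^ k *
      (ζ ^ (l : ℕ) * (ζ ^ (l : ℕ) - ζ ^ (j : ℕ))⁻¹) = ((n : ℂ) - 1) / 2 - k := by
  set μ : ℕ → ℂ := fun k => ∑ l : Fin n, (ζ ^ (l : ℕ) / ζ ^ (j : ℕ)) ^ k *
      (ζ ^ (l : ℕ) * (ζ ^ (l : ℕ) - ζ ^ (j : ℕ))⁻¹) with hμ
  have hz : ∀ i : ℕ, ζ ^ i ≠ 0 := fun i => pow_ne_zero _ (hζ.ne_zero (by omega))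
  have hne : ∀ l : Fin n, l ≠ j → ζ ^ (l : ℕ) - ζ ^ (j : ℕ) ≠ 0 := fun l hl =>
    sub_ne_zero.2 fun h => hl (Fin.ext (hζ.pow_inj l.2 j.2 h))
  -- With w = ζ^(l-j), consecutive sums differ by ∑ w^(k+1) over l ≠ j; the full sum is 0 and the
  -- missing term is 1.
  have hstep : ∀ k, k + 1 < n → μ (k + 1) = μ k - 1 := by
    intro k hk
    rw [sub_eq_add_neg, ← sub_eq_iff_eq_add']
    simp only [hμ]
    rw [← sum_sub_distrib]
    have h1 : ∀ l : Fin n, (ζ ^ (l : ℕ) / ζ ^ (j : ℕ)) ^ (k + 1) *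
        (ζ ^ (l : ℕ) * (ζ ^ (l : ℕ) - ζ ^ (j : ℕ))⁻¹) - (ζ ^ (l : ℕ) / ζ ^ (j : ℕ)) ^ k *
        (ζ ^ (l : ℕ) * (ζ ^ (l : ℕ) - ζ ^ (j : ℕ))⁻¹) =
        (ζ ^ (l : ℕ)) ^ (k + 1) / (ζ ^ (j : ℕ)) ^ (k + 1) - if l = j then 1 else 0 := by
      intro l
      have hj := hz j
      split_ifs with h
      · subst h
        simp [hj]
      · have := hne l h
        rw [← div_pow, sub_zero, pow_succ]
        field_simp
    simp_rw [h1]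
    rw [sum_sub_distrib, ← sum_div, sum_pow_pow_eq_zero hζ (Nat.not_dvd_of_pos_of_lt (by omega) hk)]
    simp
  have hlin : ∀ k, k < n → μ k = μ 0 - k := by
    intro k
    induction k with
    | zero => simp
    | succ k ih =>
      intro hk
      rw [hstep k hk, ih (by omega)]
      push_cast
      ring
  -- This fixes `μ 0`: for l ≠ j the geometric sum of w^k vanishes, and for l = j the other factor
  -- is 0.
  have hsum : ∑ k ∈ range n, μ k = 0 := by
    simp only [hμ]
    rw [sum_comm]
    refine sum_eq_zero fun l _ => ?_
    rw [← sum_mul]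
    by_cases h : l = j
    · simp [h]
    · have h1 := geom_sum_mul (ζ ^ (l : ℕ) / ζ ^ (j : ℕ)) n
      rw [div_pow, ← pow_mul, ← pow_mul, mul_comm _ n, mul_comm _ n, pow_mul, pow_mul,
        hζ.pow_eq_one, one_pow, one_pow, div_one, sub_self] at h1
      rw [(mul_eq_zero.1 h1).resolve_right, zero_mul]
      rw [div_sub_one (hz j)]
      exact div_ne_zero (hne l h) (hz j)
  rw [sum_congr rfl (fun k hk => hlin k (mem_range.1 hk)), sum_sub_distrib, sum_const,
    card_range, nsmul_eq_mul] at hsum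
  have hg : (∑ k ∈ range n, (k : ℂ)) * 2 = n * (n - 1) := by
    have := congrArg (Nat.cast (R := ℂ)) (Finset.sum_range_id_mul_two n)
    push_cast [Nat.cast_sub hn.le] at this
    exact this
  have hn0 : (n : ℂ) ≠ 0 := by exact_mod_cast (by omega : n ≠ 0)
  have h0 : μ 0 = ((n : ℂ) - 1) / 2 := by
    apply mul_left_cancel₀ hn0
    linear_combination hsum + hg / 2
  rw [← h0]
  exact hlin k hk

/-- The eigenvectors of `diffMatrix ζ n` are the columns of the Fourier matrix. -/
theorem diffMatrix_mul_vandermonde {n : ℕ} {ζ : ℂ} (hζ : IsPrimitiveRoot ζ n) (hn : 1 < n) :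
    diffMatrix ζ n * Matrix.vandermonde (fun j : Fin n => ζ ^ (j : ℕ)) =
      Matrix.vandermonde (fun j : Fin n => ζ ^ (j : ℕ)) *
        Matrix.diagonal (fun k : Fin n => ((n : ℂ) - 1) / 2 - (k : ℕ)) := by
  ext j k
  have hz : ζ ^ (j : ℕ) ≠ 0 := pow_ne_zero _ (hζ.ne_zero (by omega))
  rw [Matrix.mul_diagonal, Matrix.mul_apply, ← sum_ratio_pow_mul hζ hn j k.2, mul_sum]
  refine sum_congr rfl fun l _ => ?_
  simp only [diffMatrix, Matrix.of_apply, Matrix.vandermonde_apply, div_pow]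
  field_simp

theorem det_vandermonde_pow_ne_zero {n : ℕ} {ζ : ℂ} (hζ : IsPrimitiveRoot ζ n) :
    (Matrix.vandermonde (fun j : Fin n => ζ ^ (j : ℕ))).det ≠ 0 :=
  Matrix.det_vandermonde_ne_zero_iff.2 fun i j h => Fin.ext (hζ.pow_inj i.2 j.2 h)

theorem det_diffMatrix_eq_prod {n : ℕ} {ζ : ℂ} (hζ : IsPrimitiveRoot ζ n) (hn : 1 < n) :
    (diffMatrix ζ n).det = ∏ k : Fin n, (((n : ℂ) - 1) / 2 - (k : ℕ)) := by
  have h := congrArg Matrix.det (diffMatrix_mul_vandermonde hζ hn)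
  rw [Matrix.det_mul, Matrix.det_mul, mul_comm, Matrix.det_diagonal] at h
  exact mul_left_cancel₀ (det_vandermonde_pow_ne_zero hζ) h

/-- The conjugate Fourier matrix inverts the Fourier matrix up to the factor `n`. -/
theorem fourier_mul_vandermonde {n : ℕ} {ζ : ℂ} (hζ : IsPrimitiveRoot ζ n) :
    (Matrix.of fun k j : Fin n => (ζ ^ (j : ℕ)) ^ (n - (k : ℕ))) *
      Matrix.vandermonde (fun j : Fin n => ζ ^ (j : ℕ)) =
      (n : ℂ) • (1 : Matrix (Fin n) (Fin n) ℂ) := by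
  ext a b
  simp only [Matrix.mul_apply, Matrix.of_apply, Matrix.vandermonde_apply, ← pow_add,
    Matrix.smul_apply, Matrix.one_apply, smul_eq_mul]
  split_ifs with h
  · subst h
    simp [Nat.sub_add_cancel a.2.le, pow_right_comm ζ _ n, hζ.pow_eq_one]
  · refine (sum_pow_pow_eq_zero hζ ?_).trans (mul_zero _).symm
    rintro ⟨c, hc⟩
    have ha := a.2
    have hb := b.2
    have hab : (a : ℕ) ≠ b := fun h' => h (Fin.ext h')
    have hc1 : c < 2 := by
      by_contra! h2
      have := Nat.mul_le_mul_left n h2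
      omega
    interval_cases c <;> omega

/-- Taking adjugates in D V = V Λ gives det V · adj D = V · adj Λ · adj V. As Λ vanishes at `m`, adj
Λ has a single nonzero entry, and n · adj V = det V · W. -/
theorem adjugate_diffMatrix_apply_self {n : ℕ} {ζ : ℂ} (hζ : IsPrimitiveRoot ζ n) (hn : 1 < n)
    (m : Fin n) (hm : ((n : ℂ) - 1) / 2 - (m : ℕ) = 0) (j : Fin n) :
    (n : ℂ) * (diffMatrix ζ n).adjugate j j =
      ∏ k ∈ univ.erase m, (((n : ℂ) - 1) / 2 - (k : ℕ)) := by
  set V := Matrix.vandermonde (fun j : Fin n => ζ ^ (j : ℕ)) with hV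
  set W : Matrix (Fin n) (Fin n) ℂ := Matrix.of fun k j => (ζ ^ (j : ℕ)) ^ (n - (k : ℕ)) with hW
  set c := ∏ k ∈ univ.erase m, (((n : ℂ) - 1) / 2 - (k : ℕ)) with hc
  have hd : V.det ≠ 0 := det_vandermonde_pow_ne_zero hζ
  have h1 := congrArg (V * Matrix.adjugate ·) (diffMatrix_mul_vandermonde hζ hn)
  simp only [Matrix.adjugate_mul_distrib, Matrix.adjugate_diagonal] at h1
  rw [← Matrix.mul_assoc, Matrix.mul_adjugate] at h1
  have hdiag : (Matrix.diagonal fun i : Fin n =>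
      ∏ k ∈ univ.erase i, (((n : ℂ) - 1) / 2 - (k : ℕ))) = Matrix.single m m c := by
    ext a b
    rw [Matrix.diagonal_apply, Matrix.single_apply]
    by_cases hab : a = b
    · subst hab
      by_cases ham : m = a
      · subst ham
        simp [hc]
      · simp only [ham, if_true, false_and, if_false]
        exact prod_eq_zero (mem_erase.2 ⟨ham, mem_univ m⟩) hm
    · rw [if_neg hab, if_neg fun h => hab (h.1.symm.trans h.2)]
  have h2 : V.det • W = (n : ℂ) • V.adjugate := by
    have := congrArg (· * V.adjugate) (fourier_mul_vandermonde hζ)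
    simp only [Matrix.mul_assoc, ← hV, Matrix.mul_adjugate] at this
    rwa [Matrix.mul_smul, Matrix.mul_one, Matrix.smul_mul, Matrix.one_mul] at this
  have h3 := congrFun (congrFun h1 j) j
  rw [hdiag, ← Matrix.mul_assoc, Matrix.mul_apply (M := V * _), sum_eq_single m, smul_mul_assoc,
    Matrix.one_mul] at h3
  · have h4 := congrFun (congrFun h2 m) j
    have h5 : V j m * W m j = 1 := by
      simp [hV, hW, Matrix.vandermonde_apply, ← pow_add, Nat.add_sub_cancel' m.2.le,
        pow_right_comm ζ _ n, hζ.pow_eq_one]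
    simp at h3 h4
    apply mul_left_cancel₀ hd
    linear_combination (n : ℂ) * h3 - V j m * c * h4 + V.det * c * h5
  · intro b _ hb
    simp [hb]
  · simp

theorem det_diffMatrix_pred {m : ℕ} {ζ : ℂ} (hζ : IsPrimitiveRoot ζ (2 * m + 1)) (hm : 0 < m) :
    ((2 * m + 1 : ℕ) : ℂ) * (diffMatrix ζ (2 * m)).det =
      ∏ k ∈ univ.erase (⟨m, by omega⟩ : Fin (2 * m + 1)), ((m : ℂ) - (k : ℕ)) := by
  have h := adjugate_diffMatrix_apply_self hζ (by omega) ⟨m, by omega⟩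
    (by push_cast; ring) (Fin.last _)
  rw [Matrix.adjugate_fin_succ_eq_det_submatrix, ← two_mul, pow_mul, neg_one_sq, one_pow,
    one_mul] at h
  have h1 : (((2 * m + 1 : ℕ) : ℂ) - 1) / 2 = m := by push_cast; ring
  rw [h1] at h
  rw [← h]
  congr 2
  ext a b
  simp [diffMatrix]

/-! ### Evaluation of the eigenvalue products -/

theorem prod_range_half_sub (m : ℕ) :
    ∏ k ∈ range (2 * m), ((((2 * m : ℕ) : ℂ) - 1) / 2 - (k : ℂ)) =
      (-1) ^ m * (((Nat.doubleFactorial (2 * m - 1) : ℕ) : ℂ) ^ 2 / 2 ^ (2 * m)) := by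
  induction m with
  | zero => simp
  | succ m ih =>
    have h1 : Nat.doubleFactorial (2 * (m + 1) - 1) =
        (2 * m + 1) * Nat.doubleFactorial (2 * m - 1) := by
      cases m with
      | zero => rfl
      | succ m => exact Nat.doubleFactorial_add_two (2 * m + 1)
    -- The two end factors ±(2m+1)/2 split off; the rest, shifted by one, is the previous product.
    rw [h1, show 2 * (m + 1) = 2 * m + 1 + 1 by ring, prod_range_succ, prod_range_succ']
    have h2 : ∀ k ∈ range (2 * m), (((2 * m + 1 + 1 : ℕ) : ℂ) - 1) / 2 - ((k + 1 : ℕ) : ℂ) =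
        (((2 * m : ℕ) : ℂ) - 1) / 2 - (k : ℂ) := fun k _ => by push_cast; ring
    rw [prod_congr rfl h2, ih]
    push_cast
    field_simp
    ring

theorem prod_range_sub_eq_factorial (m : ℕ) : ∏ k ∈ range m, ((m : ℂ) - k) = (m.factorial : ℂ) := by
  induction m with
  | zero => simp
  | succ m ih =>
    rw [prod_range_succ', Nat.factorial_succ, Nat.cast_mul, ← ih, mul_comm]
    simp

theorem prod_erase_sub_eq (m : ℕ) :
    ∏ k ∈ univ.erase (⟨m, by omega⟩ : Fin (2 * m + 1)), ((m : ℂ) - (k : ℕ)) =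
      (-1) ^ m * (m.factorial : ℂ) ^ 2 := by
  -- Replacing the zero factor by 1 turns this into a product over the full range.
  have h1 : ∏ k ∈ univ.erase (⟨m, by omega⟩ : Fin (2 * m + 1)), ((m : ℂ) - (k : ℕ)) =
      ∏ k ∈ univ.erase (⟨m, by omega⟩ : Fin (2 * m + 1)),
        (if (k : ℕ) = m then 1 else (m : ℂ) - (k : ℕ)) :=
    prod_congr rfl fun k hk => by
      rw [if_neg fun h => ne_of_mem_erase hk (Fin.ext h)]
  rw [h1, prod_erase _ (by simp),
    Fin.prod_univ_eq_prod_range (fun k => if k = m then (1 : ℂ) else (m : ℂ) - k),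
    show 2 * m + 1 = m + 1 + m by ring, prod_range_add, prod_range_succ]
  have h2 : ∏ k ∈ range m, (if k = m then (1 : ℂ) else (m : ℂ) - k) = m.factorial := by
    rw [← prod_range_sub_eq_factorial]
    exact prod_congr rfl fun k hk => if_neg (mem_range.1 hk).ne
  have h3 : ∏ k ∈ range m, (if m + 1 + k = m then (1 : ℂ) else (m : ℂ) - (m + 1 + k : ℕ)) =
      (-1) ^ m * m.factorial := by
    rw [← prod_range_add_one_eq_factorial, Nat.cast_prod]
    have h4 : (-1 : ℂ) ^ m = ∏ _k ∈ range m, (-1 : ℂ) := by simp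
    rw [h4, ← prod_mul_distrib]
    refine prod_congr rfl fun k _ => ?_
    rw [if_neg (by omega)]
    push_cast
    ring
  rw [h2, h3, if_pos rfl]
  ring

theorem doubleFactorial_sq_div_eq (m : ℕ) :
    ((Nat.doubleFactorial (2 * m - 1) : ℕ) : ℂ) ^ 2 / 2 ^ (2 * m) =
      ((Nat.factorial (2 * m) : ℕ) : ℂ) / 4 ^ (2 * m) * ((Nat.choose (2 * m) m : ℕ) : ℂ) := by
  have h1 : (2 * m).factorial = 2 ^ m * m.factorial * Nat.doubleFactorial (2 * m - 1) := by
    cases m with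
    | zero => rfl
    | succ m =>
      rw [← Nat.doubleFactorial_two_mul]
      exact Nat.factorial_eq_mul_doubleFactorial (2 * m + 1)
  have h2 : (Nat.choose (2 * m) m) * m.factorial ^ 2 = (2 * m).factorial := by
    have := Nat.choose_mul_factorial_mul_factorial (show m ≤ 2 * m by omega)
    rw [show 2 * m - m = m by omega] at this
    rw [← this]
    ring
  have hm : (m.factorial : ℂ) ^ 2 ≠ 0 := by exact_mod_cast pow_ne_zero 2 m.factorial_ne_zero
  have h3 : (Nat.choose (2 * m) m : ℂ) = ((2 * m).factorial : ℂ) / (m.factorial : ℂ) ^ 2 := by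
    rw [eq_div_iff hm]
    exact_mod_cast h2
  have h5 : (4 : ℂ) ^ (2 * m) = (2 ^ m) ^ 4 := by
    rw [show (4 : ℂ) = 2 ^ 2 by norm_num, ← pow_mul, ← pow_mul]
    congr 1
    ring
  have h6 : (2 : ℂ) ^ (2 * m) = (2 ^ m) ^ 2 := by rw [← pow_mul, mul_comm]
  rw [h3, h1, h5, h6]
  have : (m.factorial : ℂ) ≠ 0 := by exact_mod_cast m.factorial_ne_zero
  have h4 : (2 : ℂ) ^ m ≠ 0 := pow_ne_zero _ two_ne_zero
  push_cast
  generalize (2 : ℂ) ^ m = t at *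
  field_simp

theorem mainTheorem2 (n : ℕ) (hn : 1 < n) (ζ : ℂ) (hζ : IsPrimitiveRoot ζ n) :
    (Even n →
      derangementSum ζ n = ((Nat.doubleFactorial (n - 1) : ℕ) : ℂ) ^ 2 / 2 ^ n ∧
      ((Nat.doubleFactorial (n - 1) : ℕ) : ℂ) ^ 2 / 2 ^ n =
        ((Nat.factorial n : ℕ) : ℂ) / 4 ^ n * ((Nat.choose n (n / 2) : ℕ) : ℂ)) ∧
    (Odd n →
      derangementSum ζ (n - 1) =
        1 / (n : ℂ) * ((Nat.factorial ((n - 1) / 2) : ℕ) : ℂ) ^ 2) := by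
  constructor
  · intro he
    obtain ⟨m, hm⟩ := he.two_dvd
    subst hm
    refine ⟨?_, ?_⟩
    · rw [derangementSum_eq_det hζ (by omega) m le_rfl, det_diffMatrix_eq_prod hζ hn,
        Fin.prod_univ_eq_prod_range (fun k => (((2 * m : ℕ) : ℂ) - 1) / 2 - (k : ℂ)),
        prod_range_half_sub, ← mul_assoc, ← mul_pow]
      simp
    · rw [doubleFactorial_sq_div_eq, Nat.mul_div_cancel_left m two_pos]
  · rintro ⟨m, hm⟩
    subst hm
    have hn0 : ((2 * m + 1 : ℕ) : ℂ) ≠ 0 := by exact_mod_cast (2 * m).succ_ne_zero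
    have h := det_diffMatrix_pred hζ (by omega)
    rw [prod_erase_sub_eq] at h
    rw [Nat.add_sub_cancel, Nat.mul_div_cancel_left m two_pos,
      derangementSum_eq_det hζ (by omega) m (by omega)]
    apply mul_left_cancel₀ hn0
    rw [mul_left_comm, h, ← mul_assoc, ← mul_assoc, ← mul_pow, mul_one_div_cancel hn0]
    simp
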